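/- A structural causal model (SCM) is a tuple $\mathcal M=\langle I,J,\mathcal X,\mathcal E,f,\mathbb P_{\mathcal E}\rangle$ where $I$ and $J$ are finite index sets, $\mathcal X=\prod_{i\in I}\mathcal X_i$ and $\mathcal E=\prod_{j\in J}\mathcal E_j$ are products of standard measurable spaces, $f:\mathcal X\times\mathcal E\to\mathcal X$ is measurable, and $\mathbb P_{\mathcal E}=\prod_{j\in J}\mathbb P_{\mathcal E_j}$ is a product of probability measures $\mathbb P_{\mathcal E_j}$ on $\mathcal E_j$. An exogenous index $j\in J$ is a functional parent of $k\in I$ if there is no measurable $\tilde f_k:\mathcal X\times\prod_{l\in J\setminus\{j\}}\mathcal E_l\to\mathcal X_k$ such that for $\mathbb P_{\mathcal E}$-almost every $e$, for all $x\in\mathcal X$: $x_k=f_k(x,e)\iff x_k=\tilde f_k(x,e_{J\setminus\{j\}})$. Likewise, $i\in I$ is a functional parent of $k\in I$ if there is no measurable $\tilde f_k:\prod_{l\in I\setminus\{i\}}\mathcal X_l\times\mathcal E\to\mathcal X_k$ such that for $\mathbb P_{\mathcal E}$-almost every $e$, for all $x\in\mathcal X$: $x_k=f_k(x,e)\iff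 x_k=\tilde f_k(x_{I\setminus\{i\}},e)$. For $O\subseteq I$, let $\mathrm{pa}(O)\subseteq I\sqcup J$ be the set of all functional parents of elements of $O$. For $U\subseteq I\sqcup J$, write $\mathcal X_U=\prod_{i\in U\cap I}\mathcal X_i$ and $\mathcal E_U=\prod_{j\in U\cap J}\mathcal E_j$, and similarly $x_U$, $e_U$. The SCM is solvable with respect to $O\subseteq I$ if there is a measurable map $g_O:\mathcal X_{\mathrm{pa}(O)\setminus O}\times\mathcal E_{\mathrm{pa}(O)}\to\mathcal X_O$ such that for $\mathbb P_{\mathcal E}$-almost every $e$, for all $x\in\mathcal X$, $$x_O=g_O(x_{\mathrm{pa}(O)\setminus O},e_{\mathrm{pa}(O)})\implies x_O=f_O(x,e),$$ and it is solvable if it is solvable with respect to $I$. Its solution space is $\mathcal S(\mathcal M)=\{(e,x)\in\mathcal E\times\mathcal X : x=f(x,e)\}$; let $\mathrm{pr}_{\mathcal E}:\mathcal E\times\mathcal X\to\mathcal E$ be the projection. **Theorem.** Let $\mathcal M$ be an SCM. 1. $\mathcal M$ is solvable if and only if $\mathcal E\setminus\mathrm{pr}_{\mathcal E}(\mathcal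 S(\mathcal M))$ is a $\mathbb P_{\mathcal E}$-null set (that is, it is contained in a measurable set of $\mathbb P_{\mathcal E}$-measure zero). 2. $\mathcal M$ is solvable if and only if for $\mathbb P_{\mathcal E}$-almost every $e\in\mathcal E$ the structural equations $x=f(x,e)$ have a solution $x\in\mathcal X$. -/

import Mathlib

open MeasureTheory

/-- A structural causal model `⟨I, J, ∏ X i, ∏ E j, f, ∏ P j⟩` with endogenous index set `I`,
exogenous index set `J` and standard Borel codomains `X i`, `E j`. No acyclicity is assumed. -/
structure SCM (I J : Type*) [Fintype I] [Fintype J] (X : I → Type*) (E : J → Type*)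
    [∀ i, MeasurableSpace (X i)] [∀ i, StandardBorelSpace (X i)]
    [∀ j, MeasurableSpace (E j)] [∀ j, StandardBorelSpace (E j)] where
  /-- the causal mechanism -/
  f : (∀ i, X i) × (∀ j, E j) → ∀ i, X i
  measurable_f : Measurable f
  /-- the exogenous probability measures -/
  P : ∀ j, Measure (E j)
  isProbabilityMeasure_P : ∀ j, IsProbabilityMeasure (P j)

namespace SCM

variable {I J : Type*} [Fintype I] [Fintype J] {X : I → Type*} {E : J → Type*}
  [∀ i, MeasurableSpace (X i)] [∀ i, StandardBorelSpace (X i)]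
  [∀ j, MeasurableSpace (E j)] [∀ j, StandardBorelSpace (E j)]

instance (M : SCM I J X E) (j : J) : IsProbabilityMeasure (M.P j) :=
  M.isProbabilityMeasure_P j

/-- The exogenous distribution `P_E = ∏ P j` on `∏ E j`. -/
noncomputable def exo (M : SCM I J X E) : Measure (∀ j, E j) :=
  Measure.pi M.P

instance (M : SCM I J X E) : IsProbabilityMeasure M.exo :=
  inferInstanceAs (IsProbabilityMeasure (Measure.pi M.P))

/-- Equivalence of two mechanisms for the `k`-th variable: for `P_E`-almost every `e`, for all `x`,
`x_k = g (x, e)` iff `x_k = g' (x, e)`. A mechanism that depends on a subset of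
the variables is regarded as a function of all of them. -/
def MechEquiv (M : SCM I J X E) (k : I) (g g' : (∀ i, X i) × (∀ j, E j) → X k) : Prop :=
  ∀ᵐ e ∂M.exo, ∀ x : ∀ i, X i, x k = g (x, e) ↔ x k = g' (x, e)

/-- The endogenous variable `i` is a functional parent of `k`: the `k`-th component of `f` is not
equivalent to any measurable function on `X_{I \ {i}} × E`. -/
def EndoParent (M : SCM I J X E) (i k : I) : Prop :=
  ¬ ∃ g : (∀ l : ({i}ᶜ : Set I), X l) × (∀ j, E j) → X k, Measurable g ∧
    M.MechEquiv k (fun p => M.f p k) (fun p => g (Set.domRestrict {i}ᶜ p.1, p.2))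

/-- The exogenous variable `j` is a functional parent of `k`: the `k`-th component of `f` is not
equivalent to any measurable function on `X × E_{J \ {j}}`. -/
def ExoParent (M : SCM I J X E) (j : J) (k : I) : Prop :=
  ¬ ∃ g : (∀ i, X i) × (∀ l : ({j}ᶜ : Set J), E l) → X k, Measurable g ∧
    M.MechEquiv k (fun p => M.f p k) (fun p => g (p.1, Set.domRestrict {j}ᶜ p.2))

/-- The augmented functional graph, with nodes `I ⊕ J` (self-loops allowed). -/
def augmentedGraph (M : SCM I J X E) : Digraph (I ⊕ J) where
  Adj
    | Sum.inl i, Sum.inl k => M.EndoParent i k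
    | Sum.inr j, Sum.inl k => M.ExoParent j k
    | _, Sum.inr _ => False

/-- The parents `pa(U)` of a set of nodes in the augmented functional graph. -/
def pa (M : SCM I J X E) (U : Set (I ⊕ J)) : Set (I ⊕ J) :=
  {a | ∃ b ∈ U, M.augmentedGraph.Adj a b}

/-- The endogenous variables in `pa(O)`. -/
def endoPa (M : SCM I J X E) (O : Set I) : Set I :=
  Sum.inl ⁻¹' M.pa (Sum.inl '' O)

/-- The exogenous variables in `pa(O)`. -/
def exoPa (M : SCM I J X E) (O : Set I) : Set J :=
  Sum.inr ⁻¹' M.pa (Sum.inl '' O)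

/-- Solvability with respect to `O ⊆ I`: there is a measurable
`g : X_{pa(O) \ O} × E_{pa(O)} → X_O` such that for `P_E`-almost every `e`, for all `x`,
`x_O = g (x_{pa(O) \ O}, e_{pa(O)})` implies `x_O = f_O (x, e)`. -/
def SolvableWrt (M : SCM I J X E) (O : Set I) : Prop :=
  ∃ g : (∀ i : (M.endoPa O \ O : Set I), X i) × (∀ j : M.exoPa O, E j) → ∀ i : O, X i,
    Measurable g ∧ ∀ᵐ e ∂M.exo, ∀ x : ∀ i, X i,
      O.domRestrict x = g ((M.endoPa O \ O).domRestrict x, (M.exoPa O).domRestrict e) →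
        O.domRestrict x = O.domRestrict (M.f (x, e))

/-- Solvability with respect to the set of all endogenous variables. -/
def Solvable (M : SCM I J X E) : Prop :=
  M.SolvableWrt Set.univ

/-- The solution space `{(e, x) | x = f (x, e)}`. -/
def solutionSpace (M : SCM I J X E) : Set ((∀ j, E j) × (∀ i, X i)) :=
  {p | p.2 = M.f (p.2, p.1)}

end SCM

/-! Since `pa(I) \ I` is empty, a solvability map depends on the noise alone, and its values solve
the equations almost surely. Conversely, the solution space is Borel, so `exists_measurable_ae_mem`
selects a measurable a.e. solution `g e`. This `g` may still depend on noise coordinates outside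
`pa(I)`. Changing such a coordinate almost surely preserves the solution set, so Fubini allows
freezing them one at a time at suitable constants (`exists_ae_solution_piecewise`). Part 1 is part 2
reworded. -/

/-! ### Measurable selection -/

open Set Filter Topology in
/-- Inner approximation of the outer measure of an analytic set by continuous images of compact
sets. -/
theorem exists_isCompact_le_measure_image {α : Type*} [TopologicalSpace α] [MeasurableSpace α]
    (μ : Measure α) [μ.OuterRegular] {φ : (ℕ → ℕ) → α} (hφ : Continuous φ)
    {a : ENNReal} (ha : a < μ (range φ)) : ∃ K : Set (ℕ → ℕ), IsCompact K ∧ a ≤ μ (φ '' K) := by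
  have step : ∀ (n : ℕ) (A : Set (ℕ → ℕ)), ∃ m : ℕ,
      a < μ (φ '' A) → a < μ (φ '' (A ∩ {y | y n ≤ m})) := by
    intro n A
    by_cases hA : a < μ (φ '' A)
    · have hU : φ '' A = ⋃ m : ℕ, φ '' (A ∩ {y | y n ≤ m}) := by
        rw [← image_iUnion, ← inter_iUnion, inter_eq_left.2]
        exact fun y _ => mem_iUnion.2 ⟨y n, le_refl (y n)⟩
      have hmono : Monotone fun m : ℕ => φ '' (A ∩ {y | y n ≤ m}) := fun m m' h =>
        image_mono (inter_subset_inter_right _ fun y (hy : y n ≤ m) => hy.trans h)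
      have h := hA
      rw [hU, hmono.measure_iUnion] at h
      obtain ⟨m, hm⟩ := lt_iSup_iff.1 h
      exact ⟨m, fun _ => hm⟩
    · exact ⟨0, fun h => absurd h hA⟩
  choose m hm using step
  -- `A n` bounds only the coordinates below `n`; the compact `K` is the intersection of all `A n`.
  let A : ℕ → Set (ℕ → ℕ) := fun n => Nat.rec univ (fun n A => A ∩ {y | y n ≤ m n A}) n
  let b : ℕ → ℕ := fun n => m n (A n)
  have hAb : ∀ n, A n = {y | ∀ i < n, y i ≤ b i} := by
    intro n
    induction n with
    | zero => simp [A]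
    | succ n ih =>
      change A n ∩ {y | y n ≤ b n} = _
      rw [ih]
      ext y
      simp only [mem_inter_iff, mem_ofPred_eq, Nat.lt_succ_iff_lt_or_eq]
      grind
  have hAa : ∀ n, a < μ (φ '' A n) := by
    intro n
    induction n with
    | zero => simpa [A] using ha
    | succ n ih => exact hm n _ ih
  have hK : IsCompact (univ.pi fun n => Iic (b n)) :=
    isCompact_univ_pi fun n => (finite_Iic (b n)).isCompact
  refine ⟨_, hK, ?_⟩
  rw [Set.measure_eq_iInf_isOpen]
  refine le_iInf₂ fun U hKU => le_iInf fun hU => ?_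
  suffices ∃ n, A n ⊆ φ ⁻¹' U by
    obtain ⟨n, hn⟩ := this
    exact (hAa n).le.trans (measure_mono (image_subset_iff.2 hn))
  by_contra! hcon
  choose y hyA hyU using fun n => not_subset.1 (hcon n)
  -- Truncation puts `y n` into `K` without changing its coordinates below `n`, so both sequences
  -- share the limit.
  obtain ⟨z, hz, ψ, hψ, hlim⟩ := hK.tendsto_subseq (x := fun n i => min (y n i) (b i))
    fun n i _ => mem_Iic.2 (min_le_right _ _)
  have hylim : Tendsto (y ∘ ψ) atTop (𝓝 z) := by
    rw [tendsto_pi_nhds] at hlim ⊢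
    intro i
    refine (hlim i).congr' ?_
    filter_upwards [eventually_gt_atTop i] with n hn
    have h := hyA (ψ n)
    rw [hAb] at h
    exact min_eq_left (h i (hn.trans_le (hψ.id_le n)))
  have hzU : z ∈ (φ ⁻¹' U)ᶜ := (hU.preimage hφ).isClosed_compl.mem_of_tendsto hylim
    (Eventually.of_forall fun n => hyU (ψ n))
  exact hzU (hKU (mem_image_of_mem φ hz))

/-- Baire space embeds continuously into the real line. -/
theorem exists_continuous_injective_baire_real :
    ∃ u : (ℕ → ℕ) → ℝ, Continuous u ∧ Function.Injective u := by
  -- Each entry `y n` is encoded by the indicator of `{y n}`.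
  have hb : Continuous fun (y : ℕ → ℕ) (n m : ℕ) => decide (y n = m) :=
    continuous_pi fun n => continuous_pi fun m =>
      (continuous_of_discreteTopology (f := fun k : ℕ => decide (k = m))).comp (continuous_apply n)
  refine ⟨fun y => cantorSetHomeomorphNatToBool.symm
    (cantorSpaceHomeomorphNatToCantorSpace.symm fun n m => decide (y n = m)),
    continuous_subtype_val.comp (cantorSetHomeomorphNatToBool.symm.continuous.comp
      (cantorSpaceHomeomorphNatToCantorSpace.symm.continuous.comp hb)), fun y z h => ?_⟩
  have h' := cantorSpaceHomeomorphNatToCantorSpace.symm.injective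
    (cantorSetHomeomorphNatToBool.symm.injective (Subtype.val_injective h))
  funext n
  have := congrFun (congrFun h' n) (y n)
  simp only [decide_true] at this
  exact (of_decide_eq_true this.symm).symm

open Set in
/-- A continuous map on a compact set of sequences has a Borel section over its image. -/
theorem IsCompact.exists_measurable_section {α : Type*} [TopologicalSpace α] [T2Space α]
    [MeasurableSpace α] [BorelSpace α] [SecondCountableTopology α]
    {φ : (ℕ → ℕ) → α} (hφ : Continuous φ) {K : Set (ℕ → ℕ)} (hK : IsCompact K) :
    ∃ s : α → ℕ → ℕ, Measurable s ∧ ∀ x ∈ φ '' K, φ (s x) = x := by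
  obtain ⟨u, hu, hinj⟩ := exists_continuous_injective_baire_real
  -- The first projection of `D n` is compact and collects the points exceeding the fibre minimum of
  -- `u` by at least `1 / (n + 1)`. Hence the set `C` of fibre minimisers is Borel; injectivity of
  -- `u` leaves one per fibre.
  let D : ℕ → Set ((ℕ → ℕ) × (ℕ → ℕ)) := fun n =>
    (K ×ˢ K) ∩ ({p | φ p.2 = φ p.1} ∩ {p | u p.2 + 1 / ((n : ℝ) + 1) ≤ u p.1})
  have hD : ∀ n, IsCompact (D n) := fun n => (hK.prod hK).inter_right
    ((isClosed_eq (by fun_prop) (by fun_prop)).inter (isClosed_le (by fun_prop) (by fun_prop)))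
  let C : Set (ℕ → ℕ) := K \ ⋃ n, Prod.fst '' D n
  have hC : MeasurableSet C := hK.measurableSet.diff
    (MeasurableSet.iUnion fun n => ((hD n).image continuous_fst).measurableSet)
  have hCmin : ∀ y, y ∈ C ↔ y ∈ K ∧ ∀ z ∈ K, φ z = φ y → u y ≤ u z := by
    intro y
    refine and_congr_right fun hy => ⟨fun h z hz hzy => ?_, fun h hy' => ?_⟩
    · by_contra! hlt
      obtain ⟨n, hn⟩ := exists_nat_one_div_lt (sub_pos.2 hlt)
      exact h (mem_iUnion.2 ⟨n, (y, z), ⟨⟨hy, hz⟩, hzy, by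
        change u z + 1 / ((n : ℝ) + 1) ≤ u y
        linarith⟩, rfl⟩)
    · obtain ⟨n, ⟨y', z⟩, ⟨⟨_, hz⟩, hzy, hle⟩, rfl⟩ := mem_iUnion.1 hy'
      have h1 := h z hz hzy
      have h2 : u z + 1 / ((n : ℝ) + 1) ≤ u y' := hle
      have h3 : 0 < 1 / ((n : ℝ) + 1) := by positivity
      linarith
  have hCinj : InjOn φ C := by
    intro y hy z hz h
    rw [hCmin] at hy hz
    exact hinj (le_antisymm (hy.2 z hz.1 h.symm) (hz.2 y hy.1 h))
  have hemb := hφ.continuousOn.measurableEmbedding hC hCinj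
  obtain ⟨s, hs, hsφ⟩ := hemb.exists_measurable_extend measurable_subtype_coe
    fun _ => ⟨fun _ => 0⟩
  refine ⟨s, hs, ?_⟩
  rintro _ ⟨y, hy, rfl⟩
  obtain ⟨z, hz, hzmin⟩ := (hK.inter_right (isClosed_eq hφ continuous_const)).exists_isMinOn
    (⟨y, hy, rfl⟩ : (K ∩ {z | φ z = φ y}).Nonempty) hu.continuousOn
  have hzC : z ∈ C := (hCmin z).2 ⟨hz.1, fun w hw hwz => hzmin ⟨hw, hwz.trans hz.2⟩⟩
  have h : s (φ z) = z := congrFun hsφ ⟨z, hzC⟩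
  rw [← show φ z = φ y from hz.2, h]

open Set in
/-- A **measurable selection theorem** (Jankov--von Neumann, almost everywhere): a Borel relation
all of whose sections, up to a null set, are nonempty has a Borel selection almost everywhere. -/
theorem exists_measurable_ae_mem {α β : Type*} [MeasurableSpace α] [StandardBorelSpace α]
    [MeasurableSpace β] [StandardBorelSpace β] (μ : Measure α) [IsFiniteMeasure μ] [NeZero μ]
    {S : Set (α × β)} (hS : MeasurableSet S) (h : ∀ᵐ x ∂μ, ∃ y, (x, y) ∈ S) :
    ∃ g : α → β, Measurable g ∧ ∀ᵐ x ∂μ, (x, g x) ∈ S := by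
  let _ := upgradeStandardBorel α
  let _ := upgradeStandardBorel β
  obtain ⟨x₀, y₀, h₀⟩ := h.exists
  obtain hemp | ⟨F, hF, hFS⟩ := show S = ∅ ∨ _ by
    simpa only [AnalyticSet] using hS.analyticSet
  · exact absurd h₀ (hemp ▸ notMem_empty _)
  have hφ : Continuous fun y => (F y).1 := continuous_fst.comp hF
  have hfull : μ (range fun y => (F y).1) = μ univ := by
    refine measure_congr (Filter.eventuallyEq_univ.2 ?_)
    filter_upwards [h] with x ⟨y, hy⟩
    obtain ⟨t, ht⟩ := hFS.symm ▸ hy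
    exact ⟨t, congrArg Prod.fst ht⟩
  have hpos : μ univ ≠ 0 := by simp [NeZero.ne μ]
  obtain ⟨a, -, ha, hlim⟩ := exists_seq_strictMono_tendsto' (pos_iff_ne_zero.2 hpos)
  choose K hK haK using fun n => exists_isCompact_le_measure_image μ hφ
    ((ha n).2.trans_eq hfull.symm)
  choose s hs hsK using fun n => (hK n).exists_measurable_section hφ
  have hm : ∀ n, MeasurableSet ((fun y => (F y).1) '' K n) := fun n =>
    ((hK n).image hφ).measurableSet
  let N : Set α := (⋃ n, (fun y => (F y).1) '' K n)ᶜ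
  have hNm : MeasurableSet N := (MeasurableSet.iUnion hm).compl
  have hN : μ N = 0 := by
    rw [measure_compl hNm.of_compl (measure_ne_top _ _), tsub_eq_zero_iff_le]
    exact le_of_tendsto' hlim fun n => (haK n).trans
      (measure_mono (subset_iUnion (fun n => (fun y => (F y).1) '' K n) n))
  -- Adjoining the null set `N` makes the least index exist everywhere.
  let p : ℕ → α → Prop := fun n x => x ∈ (fun y => (F y).1) '' K n ∪ N
  classical
  have hp : ∀ x, ∃ n, p n x := by
    intro x
    by_cases hx : x ∈ N
    · exact ⟨0, Or.inr hx⟩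
    · obtain ⟨n, hn⟩ := mem_iUnion.1 (notMem_compl_iff.1 hx)
      exact ⟨n, Or.inl hn⟩
  refine ⟨fun x => (F (s (Nat.find (hp x)) x)).2,
    (measurable_snd.comp hF.measurable).comp
      (Measurable.find (p := p) hs (fun n => (hm n).union hNm) hp), ?_⟩
  filter_upwards [compl_mem_ae_iff.2 hN] with x hx
  have hx' := (Nat.find_spec (hp x)).resolve_right hx
  have h1 : (F (s (Nat.find (hp x)) x)).1 = x := hsK _ x hx'
  have h2 : F (s (Nat.find (hp x)) x) ∈ S := hFS ▸ mem_range_self _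
  generalize F (s (Nat.find (hp x)) x) = q at h1 h2
  subst h1
  exact h2

/-! ### Resampling noise coordinates -/

open Set in
/-- Resampling one coordinate of a product probability measure preserves it. -/
theorem measurePreserving_update_pi {ι : Type*} [Fintype ι] [DecidableEq ι] {α : ι → Type*}
    [∀ i, MeasurableSpace (α i)] (μ : ∀ i, Measure (α i)) [∀ i, IsProbabilityMeasure (μ i)]
    (i : ι) : MeasurePreserving (fun p : α i × (∀ i, α i) => Function.update p.2 i p.1)
      ((μ i).prod (Measure.pi μ)) (Measure.pi μ) := by
  have hmeas : Measurable fun p : α i × (∀ i, α i) => Function.update p.2 i p.1 := by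
    refine measurable_pi_iff.2 fun j => ?_
    obtain rfl | hj := eq_or_ne j i
    · simpa using measurable_fst
    · simp only [Function.update_of_ne hj]
      exact (measurable_pi_apply j).comp measurable_snd
  refine ⟨hmeas, (Measure.pi_eq fun s hs => ?_).symm⟩
  rw [Measure.map_apply hmeas (MeasurableSet.univ_pi hs)]
  -- The overwritten coordinate is unconstrained and contributes a factor 1.
  have hpre : (fun p : α i × (∀ i, α i) => Function.update p.2 i p.1) ⁻¹' univ.pi s =
      s i ×ˢ univ.pi (Function.update s i univ) := by
    ext p
    simp only [mem_preimage, mem_univ_pi, mem_prod]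
    refine ⟨fun h => ⟨by simpa using h i, fun j => ?_⟩, fun h j => ?_⟩
    · obtain rfl | hj := eq_or_ne j i
      · simp
      · simpa [hj] using h j
    · obtain rfl | hj := eq_or_ne j i
      · simpa using h.1
      · simpa [hj] using h.2 j
  rw [hpre, Measure.prod_prod, Measure.pi_pi, ← Finset.mul_prod_erase _ _ (Finset.mem_univ i),
    ← Finset.mul_prod_erase _ (fun j => μ j (s j)) (Finset.mem_univ i)]
  simp only [Function.update_self, measure_univ, one_mul]
  congr 1
  refine Finset.prod_congr rfl fun j hj => ?_
  rw [Function.update_of_ne (Finset.ne_of_mem_erase hj)]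

/-! ### Solvability -/

namespace SCM

variable {I J : Type*} [Fintype I] [Fintype J] {X : I → Type*} {E : J → Type*}
  [∀ i, MeasurableSpace (X i)] [∀ i, StandardBorelSpace (X i)]
  [∀ j, MeasurableSpace (E j)] [∀ j, StandardBorelSpace (E j)]

theorem measurableSet_solutionSpace (M : SCM I J X E) : MeasurableSet M.solutionSpace :=
  measurableSet_eq_fun measurable_snd (M.measurable_f.comp measurable_swap)

theorem mem_exoPa_univ (M : SCM I J X E) (j : J) :
    j ∈ M.exoPa Set.univ ↔ ∃ k, M.ExoParent j k := by
  simp [exoPa, pa, augmentedGraph]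

/-- Outside the exogenous parents, a coordinate of the noise can be resampled without changing the
set of solutions, almost surely. -/
theorem ae_ae_update_solution_iff [DecidableEq J] (M : SCM I J X E) {j : J}
    (hj : j ∉ M.exoPa Set.univ) :
    ∀ᵐ c ∂M.P j, ∀ᵐ e ∂M.exo, ∀ x,
      x = M.f (x, Function.update e j c) ↔ x = M.f (x, e) := by
  have hk : ∀ k, ¬ M.ExoParent j k := by simpa [mem_exoPa_univ] using hj
  simp only [ExoParent, not_not] at hk
  choose g _ hg using hk
  have hall := ae_all_iff.2 hg
  have hupd := Measure.ae_ae_of_ae_prod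
    ((measurePreserving_update_pi M.P j).quasiMeasurePreserving.ae hall)
  filter_upwards [hupd] with c hc
  filter_upwards [hc, hall] with e he he' x
  simp only [funext_iff]
  refine forall_congr' fun k => (he k x).trans ((he' k x).trans ?_).symm
  have : Set.domRestrict {j}ᶜ (Function.update e j c) = Set.domRestrict {j}ᶜ e := by
    funext l
    exact Function.update_of_ne l.2 _ _
  simp [this]

/-- A solution map can be made independent of finitely many exogenous non-parents by freezing them
at suitable values. -/
theorem exists_ae_solution_piecewise [DecidableEq J] (M : SCM I J X E)
    {g : (∀ j, E j) → ∀ i, X i} (hg : ∀ᵐ e ∂M.exo, g e = M.f (g e, e)) (D : Finset J)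
    (hD : ∀ j ∈ D, j ∉ M.exoPa Set.univ) :
    ∃ c : ∀ j, E j, ∀ᵐ e ∂M.exo, g (D.piecewise c e) = M.f (g (D.piecewise c e), e) := by
  induction D using Finset.induction_on with
  | empty =>
    obtain ⟨c, -⟩ := hg.exists
    exact ⟨c, by simpa using hg⟩
  | insert j D hjD ih =>
    obtain ⟨c, hc⟩ := ih fun l hl => hD l (Finset.mem_insert_of_mem hl)
    have hupd := Measure.ae_ae_of_ae_prod
      ((measurePreserving_update_pi M.P j).quasiMeasurePreserving.ae hc)
    -- A good `a` keeps the selected point a solution for the resampled noise and lets it transfer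
    -- back to `e`.
    obtain ⟨a, ha, ha'⟩ := (hupd.and (M.ae_ae_update_solution_iff
      (hD j (Finset.mem_insert_self j D)))).exists
    refine ⟨Function.update c j a, ?_⟩
    filter_upwards [ha, ha'] with e he he'
    have : (insert j D).piecewise (Function.update c j a) e =
        D.piecewise c (Function.update e j a) := by
      funext l
      obtain rfl | hl := eq_or_ne l j
      · simp [hjD]
      · by_cases hlD : l ∈ D <;> simp [hl, hlD]
    rw [this]
    exact (he' _).1 he

theorem Solvable.ae_exists {M : SCM I J X E} (h : M.Solvable) :
    ∀ᵐ e ∂M.exo, ∃ x, x = M.f (x, e) := by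
  obtain ⟨g, -, hg⟩ := h
  filter_upwards [hg] with e he
  let z : ∀ i : (M.endoPa Set.univ \ Set.univ : Set I), X i := fun i => (i.2.2 trivial).elim
  refine ⟨fun i => g (z, (M.exoPa Set.univ).domRestrict e) ⟨i, trivial⟩, ?_⟩
  have := he (fun i => g (z, (M.exoPa Set.univ).domRestrict e) ⟨i, trivial⟩) (by
    have hz : ∀ z' : ∀ i : (M.endoPa Set.univ \ Set.univ : Set I), X i, z' = z :=
      fun z' => funext fun i => (i.2.2 trivial).elim
    rw [hz (Set.domRestrict _ _)]
    rfl)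
  funext i
  exact congrFun this ⟨i, trivial⟩

theorem solvable_of_ae_exists {M : SCM I J X E} (h : ∀ᵐ e ∂M.exo, ∃ x, x = M.f (x, e)) :
    M.Solvable := by
  classical
  obtain ⟨g, hgm, hg⟩ := exists_measurable_ae_mem M.exo M.measurableSet_solutionSpace h
  obtain ⟨c, hc⟩ := M.exists_ae_solution_piecewise hg
    (Finset.univ.filter fun j => j ∉ M.exoPa Set.univ) (by simp)
  let r : (∀ j : M.exoPa Set.univ, E j) → ∀ j, E j := fun e j =>
    if hj : j ∈ M.exoPa Set.univ then e ⟨j, hj⟩ else c j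
  have hr : Measurable r := by
    refine measurable_pi_iff.2 fun j => ?_
    by_cases hj : j ∈ M.exoPa Set.univ
    · simpa only [r, hj, dite_true] using measurable_pi_apply _
    · simp only [r, hj, dite_false]
      exact measurable_const
  refine ⟨fun p i => g (r p.2) i, measurable_pi_iff.2 fun i =>
    (measurable_pi_apply i.1).comp (hgm.comp (hr.comp measurable_snd)), ?_⟩
  filter_upwards [hc] with e he x hx
  have hre : r ((M.exoPa Set.univ).domRestrict e) =
      (Finset.univ.filter fun j => j ∉ M.exoPa Set.univ).piecewise c e := by
    funext j
    by_cases hj : j ∈ M.exoPa Set.univ <;> simp [r, hj]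
  have hxg : x = g (r ((M.exoPa Set.univ).domRestrict e)) :=
    funext fun i => congrFun hx ⟨i, trivial⟩
  rw [← hre, ← hxg] at he
  exact congrArg _ he

theorem solvable_iff_ae_exists (M : SCM I J X E) :
    M.Solvable ↔ ∀ᵐ e ∂M.exo, ∃ x, x = M.f (x, e) :=
  ⟨Solvable.ae_exists, solvable_of_ae_exists⟩

theorem measure_compl_fst_solutionSpace_eq_zero_iff (M : SCM I J X E) :
    M.exo (Set.univ \ Prod.fst '' M.solutionSpace) = 0 ↔
      ∀ᵐ e ∂M.exo, ∃ x, x = M.f (x, e) := by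
  have h : Set.univ \ Prod.fst '' M.solutionSpace = {e | ¬ ∃ x, x = M.f (x, e)} := by
    ext e
    simp [solutionSpace]
  rw [ae_iff, h]

end SCM

theorem mainTheorem4 {I J : Type*} [Fintype I] [Fintype J] {X : I → Type*} {E : J → Type*}
    [∀ i, MeasurableSpace (X i)] [∀ i, StandardBorelSpace (X i)]
    [∀ j, MeasurableSpace (E j)] [∀ j, StandardBorelSpace (E j)] (M : SCM I J X E) :
    (M.Solvable ↔ M.exo (Set.univ \ Prod.fst '' M.solutionSpace) = 0) ∧
    (M.Solvable ↔ ∀ᵐ e ∂M.exo, ∃ x : ∀ i, X i, x = M.f (x, e)) :=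
  ⟨M.solvable_iff_ae_exists.trans M.measure_compl_fst_solutionSpace_eq_zero_iff.symm,
    M.solvable_iff_ae_exists⟩
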